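/- For $L>0$ let $\Omega=[0,L]^2$ with periodic boundary conditions. A real vector field $U\in L^2(\Omega;\mathbb R^2)$ is written as a Fourier series $U=\sum_k\widehat U_k e^{ik\cdot x}$, $k\in\frac{2\pi}{L}\mathbb Z^2$. Let $H$ be the space of those $U$ with $\widehat U_0=0$ and $k\cdot\widehat U_k=0$ for all $k$. Put $\|U\|_\alpha^2=L^2\sum_{k\neq0}|k|^{2\alpha}|\widehat U_k|^2\in[0,\infty]$, $|U|=\|U\|_0$, $\|U\|=\|U\|_1$ and $|AU|=\|U\|_2$ (in the periodic case the Stokes operator is $A=-\Delta$), $V=\{U\in H:\|U\|<\infty\}$ and $\mathcal D(A)=\{U\in H:|AU|<\infty\}$; the norms $|\cdot|$ and $\|\cdot\|$ are used, with values in $[0,\infty]$, for elements of $V^*$ as well, through their Fourier coefficients. For $u,v\in V$ let $B(u,v)=P_\sigma(u\cdot\nabla v)\in V^*$, where $P_\sigma$ is the (extension to periodic distributions of the) orthogonal projection of $L^2(\Omega;\mathbb R^2)$ onto $H$; in Fourier coefficients, $P_\sigma$ removes the coefficient at $k=0$ and projects the one at $k\neq0$ orthogonally onto $\{z\in\mathbb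 C^2: k\cdot z=0\}$. **Lemma.** There are non-dimensional constants $C_0,C_1,C_2$ (which do not depend on $L$ or $U$) such that the following holds for every $L>0$. The constant $C_0$ is admissible in Ladyzhenskaya's inequality, $$\|U\|_{L^4(\Omega)}\le C_0|U|^{1/2}\|U\|^{1/2}\qquad\text{for all }U\in V,$$ and $$|B(U,U)|\le C_0^2\,|U|^{1/2}\,\|U\|\,|AU|^{1/2}\qquad\text{for all }U\in V$$ (the right-hand side being $+\infty$ if $U\in V\setminus\mathcal D(A)$), and $$\|B(U,U)\|\le C_1\,\|U\|\,|AU|+C_2\,|U|^{1/2}\,|AU|^{3/2}\qquad\text{for all }U\in\mathcal D(A).$$ In particular $B(U,U)\in V$ for $U\in\mathcal D(A)$. -/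

import Mathlib

open MeasureTheory
open scoped ENNReal NNReal

namespace PeriodicNS

/-- Values of planar vector fields, with the Euclidean norm. -/
abbrev Vec : Type := EuclideanSpace ℝ (Fin 2)

/-- Values of the Fourier coefficients of planar vector fields, with the Hermitian norm. -/
abbrev CVec : Type := EuclideanSpace ℂ (Fin 2)

/-- Indices of the Fourier modes. -/
abbrev Mode : Type := Fin 2 → ℤ

/-- Lebesgue measure on the periodic cell `Ω = [0, L]²`. An `L`-periodic field is given by its values
on `Ω`, up to null sets. -/
noncomputable def cellMeasure (L : ℝ) : Measure (Fin 2 → ℝ) :=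
  volume.restrict (Set.Icc 0 (fun _ => L))

/-- The wave vector `k = (2π / L) (n₁, n₂)`. -/
noncomputable def wave (L : ℝ) (n : Mode) : Vec :=
  WithLp.toLp 2 fun i => 2 * Real.pi / L * (n i : ℝ)

/-- The exponential `e^{i k · x}`, where `k` is the wave vector of the mode `n`. -/
noncomputable def expMode (L : ℝ) (n : Mode) (x : Fin 2 → ℝ) : ℂ :=
  Complex.exp (Complex.I * ((∑ i, wave L n i * x i : ℝ) : ℂ))

/-- The Fourier coefficient `Û_k = L⁻² ∫_Ω e^{-i k · x} U(x) dx`, so that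
`U = ∑ Û_k e^{i k · x}` for `U` in `L²(Ω)`. -/
noncomputable def coeff (L : ℝ) (U : (Fin 2 → ℝ) → Vec) (n : Mode) : CVec :=
  WithLp.toLp 2 fun i =>
    ((L ^ 2)⁻¹ : ℂ) * ∫ x, expMode L (-n) x * ((U x i : ℝ) : ℂ) ∂(cellMeasure L)

/-- The norm `(L² ∑_{k ≠ 0} |k|^{2α} |c_k|²)^{1/2}`, in `[0, ∞]`, of a periodic (mean-free)
distribution with Fourier coefficients `c`. -/
noncomputable def coeffNorm (L α : ℝ) (c : Mode → CVec) : ℝ≥0∞ :=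
  (ENNReal.ofReal (L ^ 2) *
    ∑' n : {n : Mode // n ≠ 0}, ENNReal.ofReal (‖wave L n‖ ^ (2 * α)) * ‖c n‖ₑ ^ 2) ^ (1 / 2 : ℝ)

/-- The norm `‖U‖_α` of a vector field. Thus `|U| = ‖U‖₀`, `‖U‖ = ‖U‖₁` and `|A U| = ‖U‖₂`. -/
noncomputable def sobolevNorm (L α : ℝ) (U : (Fin 2 → ℝ) → Vec) : ℝ≥0∞ :=
  coeffNorm L α (coeff L U)

/-- The space `H` of the real square integrable fields that are divergence free and have mean
zero. -/
def spaceH (L : ℝ) : Set ((Fin 2 → ℝ) → Vec) :=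
  {U | MemLp U 2 (cellMeasure L) ∧ coeff L U 0 = 0 ∧
    ∀ n : Mode, ∑ i, ((wave L n i : ℝ) : ℂ) * coeff L U n i = 0}

/-- `V_α = {U ∈ H : ‖U‖_α < ∞}`. -/
def spaceVα (L α : ℝ) : Set ((Fin 2 → ℝ) → Vec) :=
  {U | U ∈ spaceH L ∧ sobolevNorm L α U < ∞}

/-- `V = V₁`, the divergence free fields with mean zero in `H¹`. -/
def spaceV (L : ℝ) : Set ((Fin 2 → ℝ) → Vec) := spaceVα L 1

/-- `D(A) = V₂ = H² ∩ V`. -/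
def domainA (L : ℝ) : Set ((Fin 2 → ℝ) → Vec) := spaceVα L 2

/-- `G` is the weak partial derivative `∂_j U` in `L²(Ω)` of the periodic field `U`, tested against
the exponentials `e^{-i k · x}`: `Ĝ_k = i k_j Û_k` for every `k`. -/
def IsWeakPartial (L : ℝ) (j : Fin 2) (U G : (Fin 2 → ℝ) → Vec) : Prop :=
  MemLp G 2 (cellMeasure L) ∧
    ∀ n : Mode, coeff L G n = (Complex.I * ((wave L n j : ℝ) : ℂ)) • coeff L U n

open Classical in
/-- The weak partial derivative `∂_j U`. It exists for every `U` in `V` and is unique up to null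
sets of `Ω`. -/
noncomputable def weakPartial (L : ℝ) (j : Fin 2) (U : (Fin 2 → ℝ) → Vec) : (Fin 2 → ℝ) → Vec :=
  if h : ∃ G, IsWeakPartial L j U G then h.choose else 0

/-- The field `(u · ∇) v = u₁ ∂₁ v + u₂ ∂₂ v`, which is in `L¹(Ω)` for `u, v` in `V`. -/
noncomputable def advection (L : ℝ) (u v : (Fin 2 → ℝ) → Vec) : (Fin 2 → ℝ) → Vec :=
  fun x => ∑ j, u x j • weakPartial L j v x

/-- The projection `P_σ` on the side of the Fourier coefficients: the mean is removed, and every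
other coefficient is projected orthogonally to the plane of the vectors `z` with `k · z = 0`. On
`L²(Ω)` this is the orthogonal projection onto `H`, and it makes sense for all periodic
distributions. -/
noncomputable def leray (L : ℝ) (c : Mode → CVec) : Mode → CVec := fun n =>
  if n = 0 then 0 else
    c n - ((∑ i, ((wave L n i : ℝ) : ℂ) * c n i) / ((‖wave L n‖ ^ 2 : ℝ) : ℂ)) •
      (WithLp.toLp 2 fun i => ((wave L n i : ℝ) : ℂ))

/-- The element `B(u, v) = P_σ ((u · ∇) v)` of `V*`, for `u, v` in `V`, given by its Fourier
coefficients. -/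
noncomputable def bilinB (L : ℝ) (u v : (Fin 2 → ℝ) → Vec) : Mode → CVec :=
  leray L (coeff L (advection L u v))

end PeriodicNS

/-! Every norm in the statement except the `L⁴` norm is `L` times a weighted `ℓ²` norm of the moduli
`a` of the Fourier coefficients, and a product of functions has coefficients bounded by a
convolution of moduli. The lemma thus reduces to inequalities for nonnegative sequences on the
lattice, where values in `[0, ∞]` remove all questions of convergence.

Two interpolation inequalities carry the proof: Ladyzhenskaya's for convolutions
(`ellTwo_conv_sq_le`) and Agmon's for the `ℓ¹` norm (`sq_tsum_le`). Both are Cauchy–Schwarz with a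
weight such as `s + |k|² / s`, where `s` is the quotient of the two norms to be interpolated. The
remaining lattice sum is at most `2 L²` for all `s ≥ 2π / L` (`tsum_lattice_le`), and Poincaré's
inequality puts `s` in this range.

The coefficients of `B(U, U)` are at most `8 (a * |k|a)`. Ladyzhenskaya's inequality for this
convolution is the estimate in `H`. For the estimate in `V`, the extra `|k|` falls on either factor:
`|k|a * |k|a` is treated by Ladyzhenskaya's inequality, `a * |k|²a` by Young's and Agmon's. -/

namespace PeriodicNS

/-! ### Sums and convolutions in `[0, ∞]`. -/

/-- **Cauchy–Schwarz** for sums in `[0, ∞]`. -/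
theorem sq_tsum_mul_le {ι : Type*} (f g : ι → ℝ≥0∞) :
    (∑' i, f i * g i) ^ 2 ≤ (∑' i, f i ^ 2) * ∑' i, g i ^ 2 := by
  let _ : MeasurableSpace ι := ⊤
  have h := ENNReal.lintegral_mul_le_Lp_mul_Lq (Measure.count : Measure ι)
    (Real.HolderConjugate.two_two) (f := f) (g := g)
    measurable_from_top.aemeasurable measurable_from_top.aemeasurable
  simp only [lintegral_count, Pi.mul_apply, ENNReal.rpow_two] at h
  calc (∑' i, f i * g i) ^ 2
      ≤ ((∑' i, f i ^ 2) ^ (1 / 2 : ℝ) * (∑' i, g i ^ 2) ^ (1 / 2 : ℝ)) ^ 2 := by gcongr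
    _ = _ := by
      rw [mul_pow, ← ENNReal.rpow_two, ← ENNReal.rpow_two, ← ENNReal.rpow_mul, ← ENNReal.rpow_mul]
      norm_num

/-- Cauchy–Schwarz with a weight. -/
theorem sq_tsum_le_weighted {ι : Type*} (f w : ι → ℝ≥0∞) (h₀ : ∀ i, w i ≠ 0)
    (ht : ∀ i, w i ≠ ∞) :
    (∑' i, f i) ^ 2 ≤ (∑' i, f i ^ 2 * w i) * ∑' i, (w i)⁻¹ := by
  have hw : ∀ x : ℝ≥0∞, (x ^ (1 / 2 : ℝ)) ^ 2 = x := fun x => by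
    rw [← ENNReal.rpow_two, ← ENNReal.rpow_mul]; norm_num
  have h := sq_tsum_mul_le (fun i => f i * (w i) ^ (1 / 2 : ℝ)) fun i => ((w i)⁻¹) ^ (1 / 2 : ℝ)
  simp only [mul_pow, hw] at h
  refine le_trans (le_of_eq ?_) h
  congr 2
  funext i
  rw [mul_assoc, ← ENNReal.mul_rpow_of_nonneg _ _ (by norm_num),
    ENNReal.mul_inv_cancel (h₀ i) (ht i)]
  simp

/-- The sum over the translates of an index. -/
theorem tsum_sub_left {G : Type*} [AddCommGroup G] (f : G → ℝ≥0∞) (n : G) :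
    ∑' k, f (n - k) = ∑' k, f k :=
  (Equiv.subLeft n).tsum_eq f

theorem tsum_sub_right {G : Type*} [AddCommGroup G] (f : G → ℝ≥0∞) (k : G) :
    ∑' n, f (n - k) = ∑' n, f n :=
  (Equiv.subRight k).tsum_eq f

/-- The convolution of two sequences in `[0, ∞]`. -/
noncomputable def conv {G : Type*} [AddCommGroup G] (a b : G → ℝ≥0∞) (n : G) : ℝ≥0∞ :=
  ∑' k, a k * b (n - k)

/-- A weighted bound for the `ℓ²` norm of a convolution. -/
theorem tsum_conv_sq_le {G : Type*} [AddCommGroup G] (a b w w' : G → ℝ≥0∞) (K : ℝ≥0∞)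
    (h₀ : ∀ k, w k ≠ 0) (ht : ∀ k, w k ≠ ∞) (h₀' : ∀ k, w' k ≠ 0) (ht' : ∀ k, w' k ≠ ∞)
    (hK : ∀ n, ∑' k, (w k)⁻¹ * (w' (n - k))⁻¹ ≤ K) :
    ∑' n, conv a b n ^ 2 ≤ K * ((∑' k, a k ^ 2 * w k) * ∑' k, b k ^ 2 * w' k) := by
  -- The weight `w k * w' (n - k)` follows the two factors of the convolution, so the double sum
  -- over `n` and `k` factors.
  have key : ∀ n, conv a b n ^ 2 ≤
      K * ∑' k, (a k ^ 2 * w k) * (b (n - k) ^ 2 * w' (n - k)) := fun n => by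
    refine (sq_tsum_le_weighted _ (fun k => w k * w' (n - k))
      (fun k => mul_ne_zero (h₀ _) (h₀' _)) fun k => ENNReal.mul_ne_top (ht _) (ht' _)).trans ?_
    rw [mul_comm]
    gcongr ?_ * ?_
    · refine le_trans (le_of_eq ?_) (hK n)
      congr 1
      funext k
      exact ENNReal.mul_inv (Or.inl (h₀ _)) (Or.inl (ht _))
    · refine le_of_eq ?_
      congr 1
      funext k
      ring
  refine (ENNReal.tsum_le_tsum key).trans ?_
  rw [ENNReal.tsum_mul_left, ENNReal.tsum_comm]
  gcongr
  simp only [ENNReal.tsum_mul_left]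
  rw [← ENNReal.tsum_mul_right]
  exact ENNReal.tsum_le_tsum fun k => by
    rw [tsum_sub_right (fun m => b m ^ 2 * w' m) k]

/-- Young's inequality `‖a * b‖₂ ≤ ‖a‖₁ ‖b‖₂`. -/
theorem tsum_conv_sq_le_of_l1 {G : Type*} [AddCommGroup G] (a b : G → ℝ≥0∞) :
    ∑' n, conv a b n ^ 2 ≤ (∑' k, a k) ^ 2 * ∑' k, b k ^ 2 := by
  have hw : ∀ x : ℝ≥0∞, x ^ (1 / 2 : ℝ) * x ^ (1 / 2 : ℝ) = x := fun x => by
    rw [← ENNReal.rpow_add_of_nonneg _ _ (by norm_num) (by norm_num)]; norm_num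
  have key : ∀ n, conv a b n ^ 2 ≤ (∑' k, a k) * ∑' k, a k * b (n - k) ^ 2 := fun n => by
    have h := sq_tsum_mul_le (fun k => a k ^ (1 / 2 : ℝ)) fun k => a k ^ (1 / 2 : ℝ) * b (n - k)
    have e : ∀ x y : ℝ≥0∞, (x ^ (1 / 2 : ℝ) * y) ^ 2 = x * y ^ 2 := fun x y => by
      rw [mul_pow, pow_two (x ^ (1 / 2 : ℝ)), hw]
    simp only [← mul_assoc, e] at h
    simpa only [conv, pow_two (_ ^ (1 / 2 : ℝ)), hw] using h
  refine (ENNReal.tsum_le_tsum key).trans ?_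
  rw [ENNReal.tsum_mul_left, ENNReal.tsum_comm, pow_two, mul_assoc]
  gcongr
  simp only [ENNReal.tsum_mul_left]
  rw [← ENNReal.tsum_mul_right]
  exact ENNReal.tsum_le_tsum fun k => by rw [tsum_sub_right (fun m => b m ^ 2) k]

/-! ### The lattice sum. -/

/-- A discrete form of the integral of `s / (s² + x²)`, uniform in `s`. Since `(s + y)² ≤ 2 (s² +
y²)`, each term is at most a difference of consecutive values of `(2 / κ) s / (s + κ N)`, and the
sum telescopes. -/
theorem tsum_nat_cauchy_le {s κ : ℝ} (hκ : 0 < κ) (hs : 0 < s) :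
    ∑' m : ℕ, ENNReal.ofReal (s / (s ^ 2 + (κ * (m + 1)) ^ 2)) ≤ ENNReal.ofReal (2 / κ) := by
  refine ENNReal.tsum_le_of_sum_range_le fun N => ?_
  rw [← ENNReal.ofReal_sum_of_nonneg fun i _ => by positivity]
  refine ENNReal.ofReal_le_ofReal ?_
  have : ∀ N : ℕ, ∑ m ∈ Finset.range N, s / (s ^ 2 + (κ * (m + 1)) ^ 2) ≤
      2 / κ - 2 / κ * (s / (s + κ * N)) := by
    intro N
    induction N with
    | zero => simp [hs.ne']
    | succ N ih =>
      rw [Finset.sum_range_succ]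
      have h1 : s / (s ^ 2 + (κ * (N + 1)) ^ 2) ≤ 2 * s / ((s + κ * N) * (s + κ * (N + 1))) := by
        rw [div_le_div_iff₀ (by positivity) (by positivity)]
        have : 0 ≤ κ * N := by positivity
        have : (s + κ * N) * (s + κ * (N + 1)) ≤ 2 * (s ^ 2 + (κ * (N + 1)) ^ 2) := by
          nlinarith [sq_nonneg (s - κ * (N + 1))]
        nlinarith
      have h2 : 2 / κ * (s / (s + κ * N)) - 2 / κ * (s / (s + κ * (N + 1 : ℕ))) =
          2 * s / ((s + κ * N) * (s + κ * (N + 1))) := by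
        push_cast
        field_simp
        ring
      linarith
  refine (this N).trans ?_
  have : 0 ≤ 2 / κ * (s / (s + κ * N)) := by positivity
  linarith

/-- Each half-line contributes `2 / κ`. The term at zero is `1 / s`, which `κ ≤ s` bounds by `1 /
κ`. -/
theorem tsum_int_cauchy_le {s κ : ℝ} (hκ : 0 < κ) (hs : κ ≤ s) :
    ∑' m : ℤ, ENNReal.ofReal (s / (s ^ 2 + (κ * m) ^ 2)) ≤ ENNReal.ofReal (5 / κ) := by
  have hs0 : 0 < s := hκ.trans_le hs
  have hA := tsum_nat_cauchy_le hκ hs0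
  rw [tsum_of_nat_of_neg_add_one ENNReal.summable ENNReal.summable,
    tsum_eq_zero_add' ENNReal.summable]
  have h5 : ENNReal.ofReal (5 / κ) =
      ENNReal.ofReal (1 / κ) + ENNReal.ofReal (2 / κ) + ENNReal.ofReal (2 / κ) := by
    rw [← ENNReal.ofReal_add (by positivity) (by positivity),
      ← ENNReal.ofReal_add (by positivity) (by positivity)]
    congr 1; ring
  rw [h5]
  refine add_le_add (add_le_add ?_ ?_) ?_
  · refine ENNReal.ofReal_le_ofReal (le_trans (le_of_eq ?_) (one_div_le_one_div_of_le hκ hs))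
    simp; field_simp
  · refine le_trans (le_of_eq ?_) hA
    simp
  · refine le_trans (le_of_eq ?_) hA
    congr 1; funext m; congr 3; push_cast; ring

theorem norm_wave_sq (L : ℝ) (n : Mode) :
    ‖wave L n‖ ^ 2 = (2 * Real.pi / L * n 0) ^ 2 + (2 * Real.pi / L * n 1) ^ 2 := by
  rw [EuclideanSpace.real_norm_sq_eq, Fin.sum_univ_two]
  rfl

theorem le_norm_wave {L : ℝ} (hL : 0 < L) {n : Mode} (hn : n ≠ 0) :
    2 * Real.pi / L ≤ ‖wave L n‖ := by
  have hκ : 0 < 2 * Real.pi / L := by positivity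
  refine (sq_le_sq₀ hκ.le (norm_nonneg _)).1 ?_
  rw [norm_wave_sq, mul_pow, mul_pow, ← mul_add]
  refine le_mul_of_one_le_right (by positivity) ?_
  have : (1 : ℤ) ≤ n 0 ^ 2 + n 1 ^ 2 := by
    by_contra! h
    have h0 : n 0 = 0 := by nlinarith [sq_nonneg (n 0), sq_nonneg (n 1)]
    have h1 : n 1 = 0 := by nlinarith [sq_nonneg (n 0), sq_nonneg (n 1)]
    exact hn (by ext i; fin_cases i <;> simp [h0, h1])
  exact_mod_cast this

/-- The lattice sum behind the two-dimensional interpolation inequalities. -/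
theorem tsum_lattice_le {L s : ℝ} (hL : 0 < L) (hs : 2 * Real.pi / L ≤ s) :
    ∑' n : Mode, ENNReal.ofReal ((s ^ 2 + ‖wave L n‖ ^ 4 / s ^ 2)⁻¹) ≤
      ENNReal.ofReal (2 * L ^ 2) := by
  set κ := 2 * Real.pi / L with hκdef
  have hκ : 0 < κ := by positivity
  have hs0 : 0 < s := hκ.trans_le hs
  -- Since `(s² + p)(s² + q) ≤ 2 s⁴ + 2 (p + q)²`, the summand is dominated by a product, and the
  -- planar sum splits into two one-dimensional ones.
  have h1 : ∀ n : Mode, ENNReal.ofReal ((s ^ 2 + ‖wave L n‖ ^ 4 / s ^ 2)⁻¹) ≤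
      ENNReal.ofReal 2 * (ENNReal.ofReal (s / (s ^ 2 + (κ * n 0) ^ 2)) *
        ENNReal.ofReal (s / (s ^ 2 + (κ * n 1) ^ 2))) := fun n => by
    rw [← ENNReal.ofReal_mul (by positivity), ← ENNReal.ofReal_mul (by positivity)]
    refine ENNReal.ofReal_le_ofReal ?_
    have hw : ‖wave L n‖ ^ 4 = ((κ * n 0) ^ 2 + (κ * n 1) ^ 2) ^ 2 := by
      rw [← norm_wave_sq]; ring
    rw [hw]
    set p := (κ * n 0) ^ 2
    set q := (κ * n 1) ^ 2
    have hp : 0 ≤ p := sq_nonneg _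
    have hq : 0 ≤ q := sq_nonneg _
    have e : 2 * (s / (s ^ 2 + p) * (s / (s ^ 2 + q))) =
        ((s ^ 2 + p) * (s ^ 2 + q) / (2 * s ^ 2))⁻¹ := by
      field_simp
    rw [e]
    refine inv_anti₀ (by positivity) ?_
    rw [div_le_iff₀ (by positivity)]
    have e2 : (s ^ 2 + (p + q) ^ 2 / s ^ 2) * (2 * s ^ 2) = 2 * s ^ 4 + 2 * (p + q) ^ 2 := by
      field_simp
    rw [e2]
    nlinarith [sq_nonneg (s ^ 2 - (p + q)), mul_nonneg hp hq]
  refine (ENNReal.tsum_le_tsum h1).trans ?_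
  rw [ENNReal.tsum_mul_left, ← (finTwoArrowEquiv ℤ).symm.tsum_eq, ENNReal.tsum_prod']
  simp only [finTwoArrowEquiv_symm_apply, Matrix.cons_val_zero, Matrix.cons_val_one,
    ENNReal.tsum_mul_left, ENNReal.tsum_mul_right]
  have h2 := tsum_int_cauchy_le hκ hs
  refine (mul_le_mul_right (mul_le_mul' h2 h2) _).trans ?_
  rw [← ENNReal.ofReal_mul (by positivity), ← ENNReal.ofReal_mul (by positivity)]
  refine ENNReal.ofReal_le_ofReal ?_
  -- The constant `2` is enough because `25 ≤ 4 π²`.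
  have e : 2 * (5 / κ * (5 / κ)) = 25 / (2 * Real.pi ^ 2) * L ^ 2 := by
    rw [hκdef]; field_simp; norm_num
  rw [e]
  gcongr
  rw [div_le_iff₀ (by positivity)]
  nlinarith [Real.pi_gt_three]

/-! ### Norms of sequences and the interpolation inequalities. -/

/-- The `ℓ²` norm of a sequence in `[0, ∞]`. -/
noncomputable def ellTwo {ι : Type*} (a : ι → ℝ≥0∞) : ℝ≥0∞ := (∑' i, a i ^ 2) ^ (1 / 2 : ℝ)

theorem ellTwo_sq {ι : Type*} (a : ι → ℝ≥0∞) : ellTwo a ^ 2 = ∑' i, a i ^ 2 := by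
  rw [ellTwo, ← ENNReal.rpow_two, ← ENNReal.rpow_mul]; norm_num

theorem eq_zero_of_ellTwo_eq_zero {ι : Type*} {a : ι → ℝ≥0∞} (h : ellTwo a = 0) : a = 0 := by
  have : ∑' i, a i ^ 2 = 0 := by rw [← ellTwo_sq, h]; simp
  ext i
  simpa using ENNReal.tsum_eq_zero.1 this i

theorem ellTwo_le_iff {ι : Type*} {a : ι → ℝ≥0∞} {r : ℝ≥0∞} :
    ellTwo a ≤ r ↔ ∑' i, a i ^ 2 ≤ r ^ 2 := by
  rw [← ellTwo_sq]
  exact (ENNReal.pow_le_pow_left_iff two_ne_zero).symm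

theorem ellTwo_mono {ι : Type*} {a b : ι → ℝ≥0∞} (h : ∀ i, a i ≤ b i) : ellTwo a ≤ ellTwo b := by
  rw [ellTwo_le_iff, ellTwo_sq]
  exact ENNReal.tsum_le_tsum fun i => by gcongr; exact h i

theorem ellTwo_const_mul {ι : Type*} (C : ℝ≥0∞) (a : ι → ℝ≥0∞) :
    ellTwo (fun i => C * a i) = C * ellTwo a := by
  rw [ellTwo, ellTwo]
  simp only [mul_pow, ENNReal.tsum_mul_left]
  rw [ENNReal.mul_rpow_of_nonneg _ _ (by norm_num), ← ENNReal.rpow_two, ← ENNReal.rpow_mul]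
  norm_num

/-- The crude bound `(a + b)² ≤ 4 max(a, b)²` replaces Minkowski's inequality; the lost factor `2`
only affects constants. -/
theorem ellTwo_add_le {ι : Type*} (a b : ι → ℝ≥0∞) :
    ellTwo (fun i => a i + b i) ≤ 2 * (ellTwo a + ellTwo b) := by
  rw [ellTwo_le_iff]
  calc ∑' i, (a i + b i) ^ 2 ≤ ∑' i, (4 * a i ^ 2 + 4 * b i ^ 2) := by
        refine ENNReal.tsum_le_tsum fun i => ?_
        rcases le_total (a i) (b i) with h | h
        · calc (a i + b i) ^ 2 ≤ (b i + b i) ^ 2 := by gcongr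
            _ = 0 + 4 * b i ^ 2 := by ring
            _ ≤ _ := by gcongr; simp
        · calc (a i + b i) ^ 2 ≤ (a i + a i) ^ 2 := by gcongr
            _ = 4 * a i ^ 2 + 0 := by ring
            _ ≤ _ := by gcongr; simp
    _ = 4 * ellTwo a ^ 2 + 4 * ellTwo b ^ 2 := by
        rw [ENNReal.tsum_add, ENNReal.tsum_mul_left, ENNReal.tsum_mul_left, ellTwo_sq, ellTwo_sq]
    _ ≤ 4 * ellTwo a ^ 2 + 4 * ellTwo b ^ 2 + 8 * (ellTwo a * ellTwo b) := le_self_add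
    _ = (2 * (ellTwo a + ellTwo b)) ^ 2 := by ring

/-- Multiplication of the coefficients by `|k|`. -/
noncomputable def waveMul (L : ℝ) (a : Mode → ℝ≥0∞) (n : Mode) : ℝ≥0∞ := ‖wave L n‖ₑ * a n

/-- Poincaré's inequality. -/
theorem mul_ellTwo_le_ellTwo_waveMul {L : ℝ} (hL : 0 < L) {a : Mode → ℝ≥0∞} (ha : a 0 = 0) :
    ENNReal.ofReal (2 * Real.pi / L) * ellTwo a ≤ ellTwo (waveMul L a) := by
  rw [← ellTwo_const_mul]
  refine ellTwo_mono fun n => ?_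
  by_cases hn : n = 0
  · simp [hn, ha]
  · rw [waveMul, ← ofReal_norm]
    gcongr
    exact le_norm_wave hL hn

/-- The balance of two norms. -/
theorem exists_balance {x y κ : ℝ≥0∞} (hκ : κ ≠ 0) (hx : x ≠ 0) (hy : y ≠ ∞)
    (h : κ * x ≤ y) :
    ∃ s : ℝ, κ ≤ ENNReal.ofReal s ∧
      ENNReal.ofReal s * x ^ 2 = x * y ∧ ENNReal.ofReal s⁻¹ * y ^ 2 = x * y := by
  have hxt : x ≠ ∞ := fun hxt => hy (top_le_iff.1 (by
    rw [hxt, ENNReal.mul_top hκ] at h; exact h))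
  have hy0 : y ≠ 0 := fun hy0 => by
    rw [hy0, nonpos_iff_eq_zero] at h
    exact (mul_ne_zero hκ hx) h
  have hq : y / x ≠ ∞ := ENNReal.div_ne_top hy hx
  have hq0 : y / x ≠ 0 := ENNReal.div_ne_zero.2 ⟨hy0, hxt⟩
  -- The choice `s = y / x` makes `s x²` and `y² / s` equal; the hypothesis says that this quotient
  -- is at least `κ`.
  refine ⟨(y / x).toReal, ?_, ?_, ?_⟩
  · rw [ENNReal.ofReal_toReal hq, ENNReal.le_div_iff_mul_le (Or.inl hx) (Or.inl hxt)]
    exact h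
  · rw [ENNReal.ofReal_toReal hq, pow_two, ← mul_assoc, ENNReal.div_mul_cancel hx hxt, mul_comm]
  · rw [ENNReal.ofReal_inv_of_pos (ENNReal.toReal_pos hq0 hq), ENNReal.ofReal_toReal hq,
      ENNReal.inv_div (Or.inl hxt) (Or.inl hx), pow_two, ← mul_assoc,
      ENNReal.div_mul_cancel hy0 hy]

/-- A weight adapted to a sequence in `h¹`. -/
theorem exists_weight {L : ℝ} (hL : 0 < L) {a : Mode → ℝ≥0∞} (ha : a 0 = 0)
    (h₀ : ellTwo a ≠ 0) (ht : ellTwo (waveMul L a) ≠ ∞) :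
    ∃ w : Mode → ℝ≥0∞, (∀ n, w n ≠ 0) ∧ (∀ n, w n ≠ ∞) ∧
      ∑' n, a n ^ 2 * w n = 2 * (ellTwo a * ellTwo (waveMul L a)) ∧
      ∑' n, (w n)⁻¹ ^ 2 ≤ ENNReal.ofReal (2 * L ^ 2) := by
  have hκ : 0 < 2 * Real.pi / L := by positivity
  obtain ⟨s, hs, h1, h2⟩ := exists_balance (ENNReal.ofReal_pos.2 hκ).ne' h₀ ht
    (mul_ellTwo_le_ellTwo_waveMul hL ha)
  have hs0 : 0 < s := by
    by_contra! hn
    rw [ENNReal.ofReal_of_nonpos hn, nonpos_iff_eq_zero, ENNReal.ofReal_eq_zero] at hs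
    exact absurd hs (not_le.2 hκ)
  have hs' : 2 * Real.pi / L ≤ s := (ENNReal.ofReal_le_ofReal_iff hs0.le).1 hs
  have hpos : ∀ n, 0 < s + ‖wave L n‖ ^ 2 * s⁻¹ := fun n => by positivity
  -- With balanced `s`, both terms of the weight contribute the same product of norms. The square of
  -- the weight dominates `s² + |k|⁴ / s²`, the denominator in `tsum_lattice_le`.
  refine ⟨fun n => ENNReal.ofReal (s + ‖wave L n‖ ^ 2 * s⁻¹), fun n => by simpa using hpos n,
    fun n => ENNReal.ofReal_ne_top, ?_, ?_⟩
  · have : ∀ n, a n ^ 2 * ENNReal.ofReal (s + ‖wave L n‖ ^ 2 * s⁻¹) =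
        ENNReal.ofReal s * a n ^ 2 + ENNReal.ofReal s⁻¹ * waveMul L a n ^ 2 := fun n => by
      rw [ENNReal.ofReal_add hs0.le (by positivity), ENNReal.ofReal_mul (by positivity),
        ENNReal.ofReal_pow (norm_nonneg _), ofReal_norm, waveMul]
      ring
    simp only [this]
    rw [ENNReal.tsum_add, ENNReal.tsum_mul_left, ENNReal.tsum_mul_left, ← ellTwo_sq, ← ellTwo_sq,
      h1, h2, two_mul]
  · refine le_trans (ENNReal.tsum_le_tsum fun n => ?_) (tsum_lattice_le hL hs')
    rw [← ENNReal.ofReal_inv_of_pos (hpos n), ← ENNReal.ofReal_pow (by positivity)]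
    refine ENNReal.ofReal_le_ofReal ?_
    rw [inv_pow]
    refine inv_anti₀ (by positivity) ?_
    have e : (s + ‖wave L n‖ ^ 2 * s⁻¹) ^ 2 =
        s ^ 2 + ‖wave L n‖ ^ 4 / s ^ 2 + 2 * ‖wave L n‖ ^ 2 := by
      field_simp; ring
    rw [e]
    exact le_add_of_nonneg_right (by positivity)

/-- **Ladyzhenskaya's inequality** for the convolution of two sequences. -/
theorem ellTwo_conv_sq_le {L : ℝ} (hL : 0 < L) {a b : Mode → ℝ≥0∞} (ha : a 0 = 0) (hb : b 0 = 0) :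
    ellTwo (conv a b) ^ 2 ≤ ENNReal.ofReal (16 * L ^ 2) *
      (ellTwo a * ellTwo (waveMul L a) * (ellTwo b * ellTwo (waveMul L b))) := by
  by_cases hA : ellTwo a = 0
  · have := eq_zero_of_ellTwo_eq_zero hA
    rw [ellTwo_sq]
    simp [this, conv]
  by_cases hB : ellTwo b = 0
  · have := eq_zero_of_ellTwo_eq_zero hB
    rw [ellTwo_sq]
    simp [this, conv]
  have hκ : 0 < 2 * Real.pi / L := by positivity
  -- As `0 * ∞ = 0`, an infinite norm makes the right-hand side infinite only when the other factors
  -- are nonzero.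
  have hpos : ∀ {c : Mode → ℝ≥0∞}, c 0 = 0 → ellTwo c ≠ 0 → ellTwo (waveMul L c) ≠ 0 :=
    fun {c} hc hc0 h => by
      have := mul_ellTwo_le_ellTwo_waveMul hL hc
      rw [h, nonpos_iff_eq_zero] at this
      exact (mul_ne_zero (by simpa using hκ) hc0) this
  have hA' := hpos ha hA
  have hB' := hpos hb hB
  have hK : ENNReal.ofReal (16 * L ^ 2) ≠ 0 := (ENNReal.ofReal_pos.2 (by positivity)).ne'
  by_cases hAt : ellTwo (waveMul L a) = ∞
  · rw [hAt, ENNReal.mul_top hA, ENNReal.top_mul (mul_ne_zero hB hB'), ENNReal.mul_top hK]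
    exact le_top
  by_cases hBt : ellTwo (waveMul L b) = ∞
  · rw [hBt, ENNReal.mul_top hB, ENNReal.mul_top (mul_ne_zero hA hA'), ENNReal.mul_top hK]
    exact le_top
  obtain ⟨w, w0, wt, h1, h2⟩ := exists_weight hL ha hA hAt
  obtain ⟨w', w0', wt', h1', h2'⟩ := exists_weight hL hb hB hBt
  rw [ellTwo_sq]
  refine (tsum_conv_sq_le a b w w' (ENNReal.ofReal (4 * L ^ 2)) w0 wt w0' wt' fun n => ?_).trans ?_
  -- From `x y ≤ x² + y²`, the two sums of squared inverse weights bound this uniformly in `n`.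
  · calc ∑' k, (w k)⁻¹ * (w' (n - k))⁻¹ ≤ ∑' k, ((w k)⁻¹ ^ 2 + (w' (n - k))⁻¹ ^ 2) := by
          refine ENNReal.tsum_le_tsum fun k => ?_
          rcases le_total (w k)⁻¹ (w' (n - k))⁻¹ with h | h
          · refine le_add_left ?_
            rw [pow_two]; gcongr
          · refine le_add_right ?_
            rw [pow_two]; gcongr
      _ ≤ ENNReal.ofReal (2 * L ^ 2) + ENNReal.ofReal (2 * L ^ 2) := by
          rw [ENNReal.tsum_add, tsum_sub_left (fun m => (w' m)⁻¹ ^ 2)]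
          gcongr
      _ = ENNReal.ofReal (4 * L ^ 2) := by
          rw [← ENNReal.ofReal_add (by positivity) (by positivity)]
          congr 1; ring
  · rw [h1, h1']
    have : ENNReal.ofReal (16 * L ^ 2) = ENNReal.ofReal (4 * L ^ 2) * 4 := by
      rw [← ENNReal.ofReal_ofNat, ← ENNReal.ofReal_mul (by positivity)]
      congr 1; ring
    rw [this]
    refine le_of_eq ?_
    ring

/-- **Agmon's inequality**, with the `ℓ¹` norm of the coefficients. -/
theorem sq_tsum_le {L : ℝ} (hL : 0 < L) {a : Mode → ℝ≥0∞} (ha : a 0 = 0) :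
    (∑' n, a n) ^ 2 ≤
      ENNReal.ofReal (4 * L ^ 2) * (ellTwo a * ellTwo (waveMul L (waveMul L a))) := by
  by_cases hA : ellTwo a = 0
  · simp [eq_zero_of_ellTwo_eq_zero hA]
  have hκ : 0 < 2 * Real.pi / L := by positivity
  have hK : ENNReal.ofReal (4 * L ^ 2) ≠ 0 := (ENNReal.ofReal_pos.2 (by positivity)).ne'
  by_cases hAt : ellTwo (waveMul L (waveMul L a)) = ∞
  · rw [hAt, ENNReal.mul_top hA, ENNReal.mul_top hK]
    exact le_top
  have hP : ENNReal.ofReal ((2 * Real.pi / L) ^ 2) * ellTwo a ≤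
      ellTwo (waveMul L (waveMul L a)) := by
    rw [ENNReal.ofReal_pow hκ.le, pow_two, mul_assoc]
    exact (mul_le_mul_right (mul_ellTwo_le_ellTwo_waveMul hL ha) _).trans
      (mul_ellTwo_le_ellTwo_waveMul hL (by simp [waveMul, ha]))
  obtain ⟨t, ht, h1, h2⟩ := exists_balance (ENNReal.ofReal_pos.2 (pow_pos hκ 2)).ne' hA
    hAt hP
  have ht0 : 0 < t := by
    by_contra! hn
    rw [ENNReal.ofReal_of_nonpos hn, nonpos_iff_eq_zero, ENNReal.ofReal_eq_zero] at ht
    exact absurd ht (not_le.2 (pow_pos hκ 2))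
  -- Here the weight is `t + |k|⁴ / t`, so `√t` plays the role of `s` in the lattice sum; Poincaré's
  -- inequality, used twice, gives `t ≥ (2π / L)²`.
  have hs' : 2 * Real.pi / L ≤ Real.sqrt t :=
    Real.le_sqrt_of_sq_le ((ENNReal.ofReal_le_ofReal_iff ht0.le).1 ht)
  have hpos : ∀ n, 0 < t + ‖wave L n‖ ^ 4 * t⁻¹ := fun n => by positivity
  refine (sq_tsum_le_weighted a (fun n => ENNReal.ofReal (t + ‖wave L n‖ ^ 4 * t⁻¹))
    (fun n => by simpa using hpos n) fun n => ENNReal.ofReal_ne_top).trans ?_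
  have e1 : ∑' n, a n ^ 2 * ENNReal.ofReal (t + ‖wave L n‖ ^ 4 * t⁻¹) =
      2 * (ellTwo a * ellTwo (waveMul L (waveMul L a))) := by
    have : ∀ n, a n ^ 2 * ENNReal.ofReal (t + ‖wave L n‖ ^ 4 * t⁻¹) =
        ENNReal.ofReal t * a n ^ 2 + ENNReal.ofReal t⁻¹ * waveMul L (waveMul L a) n ^ 2 :=
      fun n => by
        rw [ENNReal.ofReal_add ht0.le (by positivity), ENNReal.ofReal_mul (by positivity),
          ENNReal.ofReal_pow (norm_nonneg _), ofReal_norm, waveMul, waveMul]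
        ring
    simp only [this]
    rw [ENNReal.tsum_add, ENNReal.tsum_mul_left, ENNReal.tsum_mul_left, ← ellTwo_sq, ← ellTwo_sq,
      h1, h2, two_mul]
  have e2 : ∑' n, (ENNReal.ofReal (t + ‖wave L n‖ ^ 4 * t⁻¹))⁻¹ ≤ ENNReal.ofReal (2 * L ^ 2) := by
    refine le_trans (le_of_eq ?_) (tsum_lattice_le hL hs')
    congr 1
    funext n
    rw [← ENNReal.ofReal_inv_of_pos (hpos n), Real.sq_sqrt ht0.le, div_eq_mul_inv]
  rw [e1]
  refine (mul_le_mul_right e2 _).trans (le_of_eq ?_)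
  have : ENNReal.ofReal (4 * L ^ 2) = ENNReal.ofReal (2 * L ^ 2) * 2 := by
    rw [← ENNReal.ofReal_ofNat, ← ENNReal.ofReal_mul (by positivity)]
    congr 1; ring
  rw [this]
  ring

/-! ### Fourier series on the unit torus. -/

section Torus

open UnitAddTorus Filter
open scoped ComplexConjugate Topology

/-- The circle of length one with its Haar probability measure. -/
noncomputable local instance : MeasureSpace UnitAddCircle := ⟨AddCircle.haarAddCircle⟩

local instance : Measure.IsAddHaarMeasure (volume : Measure UnitAddCircle) :=
  inferInstanceAs (Measure.IsAddHaarMeasure AddCircle.haarAddCircle)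

local instance : IsProbabilityMeasure (volume : Measure UnitAddCircle) :=
  inferInstanceAs (IsProbabilityMeasure AddCircle.haarAddCircle)

variable {d : Type*} [Fintype d]

theorem mFourierCoeff_congr_ae {F G : UnitAddTorus d → ℂ} (h : F =ᵐ[volume] G) (n : d → ℤ) :
    mFourierCoeff F n = mFourierCoeff G n :=
  integral_congr_ae (by filter_upwards [h] with t ht; rw [ht])

/-- The moduli of the Fourier coefficients. -/
noncomputable def absCoeff (F : UnitAddTorus d → ℂ) (n : d → ℤ) : ℝ≥0∞ := ‖mFourierCoeff F n‖ₑ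

/-- **Parseval's identity** with values in `[0, ∞]`. -/
theorem ellTwo_absCoeff {F : UnitAddTorus d → ℂ} (hF : MemLp F 2 volume) :
    ellTwo (absCoeff F) = eLpNorm F 2 volume := by
  have h := hasSum_sq_mFourierCoeff (hF.toLp F)
  simp only [mFourierCoeff_congr_ae hF.coeFn_toLp] at h
  have hi : ∫ t, ‖hF.toLp F t‖ ^ 2 = ∫ t, ‖F t‖ ^ 2 :=
    integral_congr_ae (by filter_upwards [hF.coeFn_toLp] with t ht; rw [ht])
  rw [hi] at h
  have h1 : ∑' n, absCoeff F n ^ 2 = ENNReal.ofReal (∫ t, ‖F t‖ ^ 2) := by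
    rw [← h.tsum_eq, ENNReal.ofReal_tsum_of_nonneg (fun _ => by positivity) h.summable]
    congr 1
    funext n
    rw [absCoeff, ENNReal.ofReal_pow (norm_nonneg _), ofReal_norm]
  rw [ellTwo, h1, ofReal_integral_eq_lintegral_ofReal
    ((memLp_two_iff_integrable_sq_norm hF.1).1 hF) (ae_of_all _ fun _ => by positivity),
    eLpNorm_eq_lintegral_rpow_enorm_toReal two_ne_zero ENNReal.ofNat_ne_top]
  simp only [ENNReal.toReal_ofNat, ENNReal.ofReal_pow (norm_nonneg _), ofReal_norm,
    ENNReal.rpow_two]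

/-- The Fourier coefficients of a product are bounded by the convolution of the coefficients. -/
theorem absCoeff_mul_le {F G : UnitAddTorus d → ℂ} (hF : MemLp F 2 volume)
    (hG : MemLp G 2 volume) (n : d → ℤ) :
    absCoeff (fun t => F t * G t) n ≤ conv (absCoeff F) (absCoeff G) n := by
  have hmF : ∀ t, ‖mFourier n t‖ ≤ 1 := fun t =>
    (ContinuousMap.norm_coe_le_norm _ t).trans_eq mFourier_norm
  -- The coefficient of `F G` at `n` is the inner product of `e_n conj(G)` with `F`, to which
  -- Parseval's identity applies.
  have hM : MemLp (fun t => mFourier n t * conj (G t)) 2 volume := by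
    refine MemLp.of_le hG
      ((mFourier n).continuous.aestronglyMeasurable.mul
        (Complex.continuous_conj.comp_aestronglyMeasurable hG.1)) (ae_of_all _ fun t => ?_)
    rw [norm_mul, RCLike.norm_conj]
    exact mul_le_of_le_one_left (norm_nonneg _) (hmF t)
  have h := hasSum_prod_mFourierCoeff (hM.toLp _) (hF.toLp F)
  simp only [mFourierCoeff_congr_ae hM.coeFn_toLp, mFourierCoeff_congr_ae hF.coeFn_toLp] at h
  have hi : ∫ t, conj (hM.toLp _ t) * hF.toLp F t = mFourierCoeff (fun t => F t * G t) n := by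
    refine integral_congr_ae ?_
    filter_upwards [hM.coeFn_toLp, hF.coeFn_toLp] with t h1 h2
    rw [h1, h2, map_mul, Complex.conj_conj, mFourier_neg, smul_eq_mul]
    ring
  have hc : ∀ k, conj (mFourierCoeff (fun t => mFourier n t * conj (G t)) k) =
      mFourierCoeff G (n - k) := fun k => by
    rw [mFourierCoeff, ← integral_conj, mFourierCoeff]
    congr 1
    funext t
    have : -(n - k) = k + -n := by abel
    rw [this, mFourier_add, mFourier_neg, mFourier_neg]
    simp [mul_assoc]
  rw [hi] at h
  rw [absCoeff, ← h.tsum_eq]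
  refine enorm_tsum_le_tsum_enorm.trans (le_of_eq ?_)
  rw [conv]
  congr 1
  funext k
  rw [hc, enorm_mul, mul_comm, absCoeff, absCoeff]

theorem eLpNorm_four_sq {α : Type*} [MeasurableSpace α] {μ : Measure α} (f : α → ℂ) :
    eLpNorm f 4 μ ^ 2 = eLpNorm (fun t => f t * f t) 2 μ := by
  have h := eLpNorm_norm_rpow (p := 2) (μ := μ) f two_pos
  have e : (2 : ℝ≥0∞) * ENNReal.ofReal 2 = 4 := by
    rw [ENNReal.ofReal_ofNat]; norm_num
  rw [e, ENNReal.rpow_two] at h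
  rw [← h]
  refine eLpNorm_congr_norm_ae (ae_of_all _ fun t => ?_)
  simp [pow_two]

theorem conv_mono {G : Type*} [AddCommGroup G] {a a' b b' : G → ℝ≥0∞} (ha : ∀ k, a k ≤ a' k)
    (hb : ∀ k, b k ≤ b' k) (n : G) : conv a b n ≤ conv a' b' n :=
  ENNReal.tsum_le_tsum fun k => mul_le_mul' (ha k) (hb _)

/-- The square of the `L⁴` norm is bounded by the `ℓ²` norm of the convolution of the Fourier
coefficients. -/
theorem eLpNorm_four_sq_le {F : UnitAddTorus d → ℂ} (hF : MemLp F 2 volume) :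
    eLpNorm F 4 volume ^ 2 ≤ ellTwo (conv (absCoeff F) (absCoeff F)) := by
  classical
  -- Parseval's identity for `F²` would need `F` in `L⁴`, which is not known yet. It is applied to
  -- the continuous partial sums, whose coefficients are dominated by those of `F`; Fatou's lemma
  -- along an almost everywhere convergent subsequence then gives the bound for `F`.
  let p : Finset (d → ℤ) → C(UnitAddTorus d, ℂ) := fun S =>
    ∑ k ∈ S, mFourierCoeff F k • mFourier k
  have hp : ∀ S, ContinuousMap.toLp (E := ℂ) 2 volume ℂ (p S) =
      ∑ k ∈ S, mFourierCoeff F k • mFourierLp 2 k := fun S => by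
    simp only [p, map_sum, map_smul]
  have hpc : ∀ S n, absCoeff (p S) n ≤ absCoeff F n := fun S n => by
    have h1 := mFourierBasis_repr (ContinuousMap.toLp (E := ℂ) 2 volume ℂ (p S)) n
    rw [mFourierCoeff_toLp, HilbertBasis.repr_apply_apply, hp, coe_mFourierBasis,
      inner_sum] at h1
    simp only [inner_smul_right, orthonormal_iff_ite.1 orthonormal_mFourier, mul_ite, mul_one,
      mul_zero, Finset.sum_ite_eq] at h1
    rw [absCoeff, ← h1]
    split_ifs
    · exact le_rfl
    · simp
  have hsum := hasSum_mFourier_series_L2 (hF.toLp F)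
  simp only [mFourierCoeff_congr_ae hF.coeFn_toLp] at hsum
  have hT : Tendsto (fun S => ContinuousMap.toLp (E := ℂ) 2 volume ℂ (p S)) atTop (𝓝 (hF.toLp F)) := by
    simp only [hp]; exact hsum
  obtain ⟨S, -, hS⟩ := (tendstoInMeasure_of_tendsto_Lp hT).exists_seq_tendsto_ae'
  have hlim : ∀ᵐ t, Tendsto (fun i => p (S i) t) atTop (𝓝 (F t)) := by
    filter_upwards [hS, hF.coeFn_toLp,
      ae_all_iff.2 fun i => ContinuousMap.coeFn_toLp (E := ℂ) (p := 2) (𝕜 := ℂ) volume (p (S i))]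
      with t h1 h2 h3
    rw [h2] at h1
    simpa only [h3] using h1
  have hb : ∀ i, eLpNorm (p (S i)) 4 volume ^ 2 ≤ ellTwo (conv (absCoeff F) (absCoeff F)) :=
    fun i => by
      have hm : ∀ q : C(UnitAddTorus d, ℂ), MemLp q 2 volume := fun q =>
        q.continuous.memLp_of_hasCompactSupport (HasCompactSupport.of_compactSpace _)
      rw [eLpNorm_four_sq]
      refine (ellTwo_absCoeff (hm (p (S i) * p (S i)))).symm.trans_le ?_
      refine ellTwo_mono fun n => (absCoeff_mul_le (hm _) (hm _) n).trans ?_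
      exact conv_mono (hpc _) (hpc _) n
  have h4 := Lp.eLpNorm_lim_le_liminf_eLpNorm (p := 4)
    (fun i => (p (S i)).continuous.aestronglyMeasurable) F hlim
  have hroot : ∀ {x y : ℝ≥0∞}, x ^ 2 ≤ y ↔ x ≤ y ^ (1 / 2 : ℝ) := fun {x y} => by
    rw [← ENNReal.rpow_two, one_div, ENNReal.le_rpow_inv_iff (by norm_num)]
  rw [hroot]
  refine h4.trans (liminf_le_of_le (by isBoundedDefault) fun b hb' => ?_)
  obtain ⟨i, hi⟩ := hb'.exists
  exact hi.trans (hroot.1 (hb i))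

/-- **Riesz–Fischer** for real functions on the torus. -/
theorem exists_real_mFourierCoeff {c : (d → ℤ) → ℂ} (hc : ∑' n, ‖c n‖ₑ ^ 2 ≠ ∞)
    (hconj : ∀ n, c (-n) = conj (c n)) :
    ∃ g : UnitAddTorus d → ℝ, MemLp g 2 volume ∧
      ∀ n, mFourierCoeff (fun t => (g t : ℂ)) n = c n := by
  have hs : Memℓp c 2 := by
    refine memℓp_gen ?_
    have : Summable fun n => (‖c n‖₊ ^ 2 : ℝ≥0) := by
      rw [← ENNReal.tsum_coe_ne_top_iff_summable]
      simpa [enorm] using hc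
    simpa using NNReal.summable_coe.2 this
  let f := (mFourierBasis (d := d)).repr.symm ⟨c, hs⟩
  have hf : ∀ n, mFourierCoeff f n = c n := fun n => by
    rw [← mFourierBasis_repr]
    simp [f]
  have hfi : Integrable f volume := (Lp.memLp f).integrable one_le_two
  have hmF : ∀ n t, ‖mFourier (d := d) n t‖ ≤ 1 := fun n t =>
    (ContinuousMap.norm_coe_le_norm _ t).trans_eq mFourier_norm
  have hint : ∀ {h : UnitAddTorus d → ℂ}, Integrable h volume → ∀ n,
      Integrable (fun t => mFourier n t • h t) volume := fun {h} hh n =>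
    hh.bdd_smul 1 (mFourier n).continuous.aestronglyMeasurable (ae_of_all _ (hmF n))
  have hfc : Integrable (fun t => conj (f t)) volume :=
    (Complex.conjCLE.toContinuousLinearMap.integrable_comp hfi)
  -- The real part has coefficients `(c n + conj (c (-n))) / 2`, which is `c n` by the symmetry of
  -- `c`.
  refine ⟨fun t => (f t).re, (Lp.memLp f).re, fun n => ?_⟩
  have e : ∀ t, mFourier (-n) t • (((f t).re : ℝ) : ℂ) =
      (1 / 2 : ℂ) * (mFourier (-n) t • f t + mFourier (-n) t • conj (f t)) := fun t => by
    rw [Complex.re_eq_add_conj]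
    simp only [smul_eq_mul]
    ring
  have h2 : ∫ t, mFourier (-n) t • conj (f t) = c n := by
    have : c n = conj (c (-n)) := by rw [hconj, Complex.conj_conj]
    rw [this, ← hf (-n), mFourierCoeff, ← integral_conj]
    congr 1
    funext t
    simp [mFourier_neg]
  rw [mFourierCoeff]
  simp only [e]
  rw [integral_const_mul, integral_add (hint hfi _) (hint hfc _), h2]
  have h1 := hf n
  rw [mFourierCoeff] at h1
  rw [h1]
  ring

/-! ### Transfer between the periodic cell and the torus. -/

/-- The point of the cell `(0, L]²` that represents a point of the torus. -/
noncomputable def unwrap (L : ℝ) (t : UnitAddTorus (Fin 2)) : Fin 2 → ℝ :=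
  L • fun i => (AddCircle.equivIoc 1 0 (t i) : ℝ)

/-- The point of the torus that is represented by a point of the plane. -/
noncomputable def wrap (L : ℝ) (x : Fin 2 → ℝ) : UnitAddTorus (Fin 2) :=
  fun i => ((L⁻¹ * x i : ℝ) : UnitAddCircle)

theorem wrap_unwrap {L : ℝ} (hL : 0 < L) (t : UnitAddTorus (Fin 2)) : wrap L (unwrap L t) = t := by
  funext i
  have : L⁻¹ * (unwrap L t i) = (AddCircle.equivIoc 1 0 (t i) : ℝ) := by
    simp [unwrap, hL.ne']
  rw [wrap, this]
  exact (AddCircle.equivIoc 1 0).symm_apply_apply (t i)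

theorem measurePreserving_unwrap_one :
    MeasurePreserving (fun (t : UnitAddTorus (Fin 2)) i => (AddCircle.equivIoc 1 0 (t i) : ℝ))
      volume (volume.restrict (Set.univ.pi fun _ : Fin 2 => Set.Ioc (0 : ℝ) 1)) := by
  have h := measurePreserving_equivPiIoc (d := Fin 2) 0
  have hS : MeasurableSet {x : Fin 2 → ℝ |
      ∀ i, x i ∈ Set.Ioc ((0 : Fin 2 → ℝ) i) ((0 : Fin 2 → ℝ) i + 1)} :=
    MeasurableSet.univ_pi' fun i => measurableSet_Ioc
  have h2 := (MeasurePreserving.mk (μa := Measure.comap Subtype.val volume) measurable_subtype_coe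
    (map_comap_subtype_coe hS volume)).comp h
  convert! h2 using 2
  ext x
  simp

theorem measurable_unwrap (L : ℝ) : Measurable (unwrap L) :=
  measurePreserving_unwrap_one.measurable.const_smul L

theorem measurable_wrap (L : ℝ) : Measurable (wrap L) :=
  measurable_pi_lambda _ fun i =>
    AddCircle.measurable_mk'.comp
      (Measurable.const_mul (f := fun x : Fin 2 → ℝ => x i) (measurable_pi_apply i) L⁻¹)

/-- Dilation by `L` scales area by `L²`, and the half-open and closed squares differ by a null set.
-/
theorem cellMeasure_eq {L : ℝ} (hL : 0 < L) :
    cellMeasure L = ENNReal.ofReal (L ^ 2) • Measure.map (unwrap L) volume := by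
  have h1 : Measure.map (unwrap L) volume = Measure.map (L • ·)
      (volume.restrict (Set.univ.pi fun _ : Fin 2 => Set.Ioc (0 : ℝ) 1)) := by
    rw [← measurePreserving_unwrap_one.map_eq,
      Measure.map_map (measurable_const_smul L) measurePreserving_unwrap_one.measurable]
    rfl
  have h2 : (Set.univ.pi fun _ : Fin 2 => Set.Ioc (0 : ℝ) 1) =
      (L • · : (Fin 2 → ℝ) → Fin 2 → ℝ) ⁻¹' (Set.univ.pi fun _ : Fin 2 => Set.Ioc (0 : ℝ) L) := by
    ext x
    simp [hL]
  have hm : MeasurableSet (Set.univ.pi fun _ : Fin 2 => Set.Ioc (0 : ℝ) L) :=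
    MeasurableSet.univ_pi fun _ => measurableSet_Ioc
  rw [h1, h2, ← Measure.restrict_map (measurable_const_smul L) hm,
    Measure.map_addHaar_smul _ hL.ne', Measure.restrict_smul, smul_smul, cellMeasure]
  have e : ENNReal.ofReal (L ^ 2) *
      ENNReal.ofReal |(L ^ Module.finrank ℝ (Fin 2 → ℝ))⁻¹| = 1 := by
    rw [← ENNReal.ofReal_mul (by positivity), abs_of_pos (by positivity)]
    simp [hL.ne']
  rw [e, one_smul]
  exact (Measure.restrict_congr_set
    (Measure.univ_pi_Ioc_ae_eq_Icc (f := fun _ : Fin 2 => (0 : ℝ)) (g := fun _ => L))).symm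

theorem ofReal_sq_ne_zero {L : ℝ} (hL : 0 < L) : ENNReal.ofReal (L ^ 2) ≠ 0 :=
  (ENNReal.ofReal_pos.2 (by positivity)).ne'

variable {E : Type*} [NormedAddCommGroup E]

theorem map_unwrap_eq {L : ℝ} (hL : 0 < L) :
    Measure.map (unwrap L) volume = (ENNReal.ofReal (L ^ 2))⁻¹ • cellMeasure L := by
  rw [cellMeasure_eq hL, smul_smul,
    ENNReal.inv_mul_cancel (ofReal_sq_ne_zero hL) ENNReal.ofReal_ne_top, one_smul]

theorem aestronglyMeasurable_map_unwrap {L : ℝ} (hL : 0 < L) {f : (Fin 2 → ℝ) → E}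
    (hf : AEStronglyMeasurable f (cellMeasure L)) :
    AEStronglyMeasurable f (Measure.map (unwrap L) volume) := by
  rw [map_unwrap_eq hL]
  exact hf.mono_ac Measure.smul_absolutelyContinuous

theorem eLpNorm_cell {L : ℝ} (hL : 0 < L) {f : (Fin 2 → ℝ) → E} {p : ℝ≥0∞} (hp : p ≠ ∞)
    (hf : AEStronglyMeasurable f (cellMeasure L)) :
    eLpNorm f p (cellMeasure L) =
      ENNReal.ofReal (L ^ 2) ^ (1 / p).toReal * eLpNorm (fun t => f (unwrap L t)) p volume := by
  rw [cellMeasure_eq hL, eLpNorm_smul_measure_of_ne_top hp, smul_eq_mul,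
    eLpNorm_map_measure (aestronglyMeasurable_map_unwrap hL hf) (measurable_unwrap L).aemeasurable]
  rfl

theorem memLp_comp_unwrap {L : ℝ} (hL : 0 < L) {f : (Fin 2 → ℝ) → E} {p : ℝ≥0∞}
    (hf : MemLp f p (cellMeasure L)) : MemLp (fun t => f (unwrap L t)) p volume := by
  refine MemLp.comp_of_map ?_ (measurable_unwrap L).aemeasurable
  rw [map_unwrap_eq hL]
  exact hf.smul_measure (ENNReal.inv_ne_top.2 (ofReal_sq_ne_zero hL))

theorem memLp_comp_wrap {L : ℝ} (hL : 0 < L) {g : UnitAddTorus (Fin 2) → E} {p : ℝ≥0∞}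
    (hg : MemLp g p volume) : MemLp (fun x => g (wrap L x)) p (cellMeasure L) := by
  have hw : MeasurePreserving (wrap L) (Measure.map (unwrap L) volume) volume := by
    refine ⟨measurable_wrap L, ?_⟩
    rw [Measure.map_map (measurable_wrap L) (measurable_unwrap L)]
    have : wrap L ∘ unwrap L = id := funext (wrap_unwrap hL)
    rw [this, Measure.map_id]
  rw [cellMeasure_eq hL]
  exact (hg.comp_measurePreserving hw).smul_measure ENNReal.ofReal_ne_top

theorem integral_cell [NormedSpace ℝ E] {L : ℝ} (hL : 0 < L) {f : (Fin 2 → ℝ) → E}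
    (hf : AEStronglyMeasurable f (cellMeasure L)) :
    ∫ x, f x ∂(cellMeasure L) = L ^ 2 • ∫ t, f (unwrap L t) := by
  rw [cellMeasure_eq hL, integral_smul_measure, ENNReal.toReal_ofReal (by positivity),
    integral_map (measurable_unwrap L).aemeasurable (aestronglyMeasurable_map_unwrap hL hf)]

theorem expMode_unwrap {L : ℝ} (hL : 0 < L) (n : Mode) (t : UnitAddTorus (Fin 2)) :
    expMode L n (unwrap L t) = mFourier n t := by
  have ht : t = fun i => ((AddCircle.equivIoc 1 0 (t i) : ℝ) : UnitAddCircle) :=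
    funext fun i => ((AddCircle.equivIoc 1 0).symm_apply_apply (t i)).symm
  conv_rhs => rw [ht]
  rw [mFourier, ContinuousMap.coe_mk, Fin.prod_univ_two, fourier_coe_apply, fourier_coe_apply,
    ← Complex.exp_add, expMode, Fin.sum_univ_two]
  congr 1
  have : (L : ℂ) ≠ 0 := by exact_mod_cast hL.ne'
  simp only [wave, unwrap, Pi.smul_apply, smul_eq_mul]
  push_cast
  field_simp

theorem continuous_expMode (L : ℝ) (n : Mode) : Continuous (expMode L n) := by
  unfold expMode
  fun_prop

/-- The component of a periodic field, as a complex function on the torus. -/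
noncomputable def comp (L : ℝ) (U : (Fin 2 → ℝ) → Vec) (i : Fin 2) (t : UnitAddTorus (Fin 2)) : ℂ :=
  ((U (unwrap L t) i : ℝ) : ℂ)

theorem memLp_apply {α : Type*} [MeasurableSpace α] {μ : Measure α} {U : α → Vec} {p : ℝ≥0∞}
    (hU : MemLp U p μ) (i : Fin 2) : MemLp (fun x => U x i) p μ :=
  (EuclideanSpace.proj (𝕜 := ℝ) i).comp_memLp' hU

theorem memLp_comp {L : ℝ} (hL : 0 < L) {U : (Fin 2 → ℝ) → Vec} {p : ℝ≥0∞}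
    (hU : MemLp U p (cellMeasure L)) (i : Fin 2) : MemLp (comp L U i) p volume :=
  (memLp_apply (memLp_comp_unwrap hL hU) i).ofReal

/-- The normalisation `L⁻²` cancels the Jacobian, so no power of `L` remains. -/
theorem coeff_apply {L : ℝ} (hL : 0 < L) {U : (Fin 2 → ℝ) → Vec}
    (hU : AEStronglyMeasurable U (cellMeasure L)) (n : Mode) (i : Fin 2) :
    coeff L U n i = mFourierCoeff (comp L U i) n := by
  have hm : AEStronglyMeasurable (fun x => expMode L (-n) x * ((U x i : ℝ) : ℂ))
      (cellMeasure L) :=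
    (continuous_expMode L _).aestronglyMeasurable.mul
      ((Complex.continuous_ofReal.comp (EuclideanSpace.proj (𝕜 := ℝ) i).continuous
        ).comp_aestronglyMeasurable hU)
  have hL' : (L : ℂ) ≠ 0 := by exact_mod_cast hL.ne'
  simp only [coeff]
  rw [integral_cell hL hm, Complex.real_smul, ← mul_assoc]
  push_cast
  rw [inv_mul_cancel₀ (pow_ne_zero 2 hL'), one_mul]
  simp only [expMode_unwrap hL]
  rfl

theorem enorm_apply_le {𝕜 : Type*} [RCLike 𝕜] (v : EuclideanSpace 𝕜 (Fin 2)) (i : Fin 2) :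
    ‖v i‖ₑ ≤ ‖v‖ₑ := by
  rw [← ofReal_norm, ← ofReal_norm]
  exact ENNReal.ofReal_le_ofReal (PiLp.norm_apply_le v i)

theorem norm_le_add {𝕜 : Type*} [RCLike 𝕜] (v : EuclideanSpace 𝕜 (Fin 2)) :
    ‖v‖ ≤ ‖v 0‖ + ‖v 1‖ := by
  rw [EuclideanSpace.norm_eq, Fin.sum_univ_two]
  refine Real.sqrt_le_iff.2 ⟨by positivity, ?_⟩
  nlinarith [mul_nonneg (norm_nonneg (v 0)) (norm_nonneg (v 1))]

theorem enorm_le_add {𝕜 : Type*} [RCLike 𝕜] (v : EuclideanSpace 𝕜 (Fin 2)) :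
    ‖v‖ₑ ≤ ‖v 0‖ₑ + ‖v 1‖ₑ := by
  rw [← ofReal_norm, ← ofReal_norm, ← ofReal_norm, ← ENNReal.ofReal_add (by positivity)
    (by positivity)]
  exact ENNReal.ofReal_le_ofReal (norm_le_add v)

/-! ### Sobolev norms and weak derivatives through coefficients. -/

/-- The moduli of the Fourier coefficients of a field. -/
noncomputable def modCoeff (L : ℝ) (U : (Fin 2 → ℝ) → Vec) (n : Mode) : ℝ≥0∞ := ‖coeff L U n‖ₑ

theorem absCoeff_comp_le {L : ℝ} (hL : 0 < L) {U : (Fin 2 → ℝ) → Vec}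
    (hU : AEStronglyMeasurable U (cellMeasure L)) (i : Fin 2) (n : Mode) :
    absCoeff (comp L U i) n ≤ modCoeff L U n := by
  rw [absCoeff, ← coeff_apply hL hU]
  exact enorm_apply_le _ _

/-- The assumption `c 0 = 0` allows the sum to include the zero mode, which matters for `m = 0`,
where its weight is `1`. -/
theorem coeffNorm_eq {L : ℝ} (hL : 0 < L) {c : Mode → CVec} (hc : c 0 = 0) (m : ℕ) :
    coeffNorm L m c = ENNReal.ofReal L * ellTwo fun n => ‖wave L n‖ₑ ^ m * ‖c n‖ₑ := by
  have h : ∀ n : Mode, ENNReal.ofReal (‖wave L n‖ ^ (2 * (m : ℝ))) * ‖c n‖ₑ ^ 2 =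
      (‖wave L n‖ₑ ^ m * ‖c n‖ₑ) ^ 2 := fun n => by
    have : (2 * (m : ℝ)) = ((m * 2 : ℕ) : ℝ) := by push_cast; ring
    rw [this, Real.rpow_natCast, ENNReal.ofReal_pow (norm_nonneg _), ofReal_norm, mul_pow, pow_mul]
  have hs : ∑' n : {n : Mode // n ≠ 0}, (‖wave L n‖ₑ ^ m * ‖c n‖ₑ) ^ 2 =
      ∑' n, (‖wave L n‖ₑ ^ m * ‖c n‖ₑ) ^ 2 := by
    refine tsum_subtype_eq_of_support_subset (s := {n : Mode | n ≠ 0})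
      (f := fun n => (‖wave L n‖ₑ ^ m * ‖c n‖ₑ) ^ 2) fun n hn h0 => hn ?_
    subst h0
    simp [hc]
  rw [coeffNorm]
  simp only [h]
  rw [hs, ENNReal.mul_rpow_of_nonneg _ _ (by norm_num), ellTwo, ENNReal.ofReal_pow hL.le,
    ← ENNReal.rpow_two, ← ENNReal.rpow_mul]
  norm_num

theorem sobolevNorm_zero {L : ℝ} (hL : 0 < L) {U : (Fin 2 → ℝ) → Vec} (hU : U ∈ spaceH L) :
    sobolevNorm L 0 U = ENNReal.ofReal L * ellTwo (modCoeff L U) := by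
  have h := coeffNorm_eq hL hU.2.1 0
  simp only [Nat.cast_zero, pow_zero, one_mul] at h
  exact h

theorem sobolevNorm_one {L : ℝ} (hL : 0 < L) {U : (Fin 2 → ℝ) → Vec} (hU : U ∈ spaceH L) :
    sobolevNorm L 1 U = ENNReal.ofReal L * ellTwo (waveMul L (modCoeff L U)) := by
  have h := coeffNorm_eq hL hU.2.1 1
  simp only [Nat.cast_one, pow_one] at h
  exact h

theorem sobolevNorm_two {L : ℝ} (hL : 0 < L) {U : (Fin 2 → ℝ) → Vec} (hU : U ∈ spaceH L) :
    sobolevNorm L 2 U = ENNReal.ofReal L * ellTwo (waveMul L (waveMul L (modCoeff L U))) := by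
  have h := coeffNorm_eq hL hU.2.1 2
  simp only [Nat.cast_ofNat, pow_two, mul_assoc] at h
  exact h

theorem modCoeff_zero {L : ℝ} {U : (Fin 2 → ℝ) → Vec} (hU : U ∈ spaceH L) :
    modCoeff L U 0 = 0 := by
  simp [modCoeff, hU.2.1]

theorem waveMul_zero {L : ℝ} {a : Mode → ℝ≥0∞} (ha : a 0 = 0) : waveMul L a 0 = 0 := by
  simp [waveMul, ha]

/-- The weak partial derivatives of a field in `V` exist. -/
theorem exists_isWeakPartial {L : ℝ} (hL : 0 < L) {U : (Fin 2 → ℝ) → Vec} (hU : U ∈ spaceV L)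
    (j : Fin 2) : ∃ G, IsWeakPartial L j U G := by
  have hUm := hU.1.1.1
  have hfin : ellTwo (waveMul L (modCoeff L U)) ≠ ∞ := fun h => by
    have h1 := hU.2
    rw [sobolevNorm_one hL hU.1, h, ENNReal.mul_top (ENNReal.ofReal_pos.2 hL).ne'] at h1
    exact lt_irrefl _ h1
  have hc : ∀ i n, ‖(Complex.I * ((wave L n j : ℝ) : ℂ)) * coeff L U n i‖ₑ ≤
      waveMul L (modCoeff L U) n := fun i n => by
    rw [enorm_mul, waveMul]
    gcongr
    · rw [enorm_mul, ← ofReal_norm Complex.I, Complex.norm_I, ENNReal.ofReal_one, one_mul,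
        ← ofReal_norm, Complex.norm_real, ofReal_norm]
      exact enorm_apply_le _ _
    · exact enorm_apply_le _ _
  have hg : ∀ i, ∃ g : UnitAddTorus (Fin 2) → ℝ, MemLp g 2 volume ∧
      ∀ n, mFourierCoeff (fun t => (g t : ℂ)) n =
        (Complex.I * ((wave L n j : ℝ) : ℂ)) * coeff L U n i := fun i => by
    refine exists_real_mFourierCoeff ?_ fun n => ?_
    · refine ne_top_of_le_ne_top (ENNReal.pow_ne_top hfin (n := 2)) ?_
      rw [ellTwo_sq]
      exact ENNReal.tsum_le_tsum fun n => by gcongr; exact hc i n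
    -- The multiplier `i k_j` is conjugated under `k ↦ -k`, so the coefficients keep the symmetry of
    -- a real function.
    · have hw : wave L (-n) j = -wave L n j := by simp [wave]
      rw [hw, coeff_apply hL hUm, coeff_apply hL hUm, map_mul, map_mul, Complex.conj_I,
        Complex.conj_ofReal]
      have : mFourierCoeff (comp L U i) (-n) = conj (mFourierCoeff (comp L U i) n) := by
        rw [mFourierCoeff, mFourierCoeff, ← integral_conj]
        congr 1
        funext t
        simp [mFourier_neg, comp]
      rw [this]
      push_cast
      ring
  choose g hg2 hgc using hg
  let G₀ : UnitAddTorus (Fin 2) → Vec := fun t => WithLp.toLp 2 fun i => g i t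
  have hG₀ : MemLp G₀ 2 volume := MemLp.of_eval_piLp hg2
  refine ⟨fun x => G₀ (wrap L x), memLp_comp_wrap hL hG₀, fun n => ?_⟩
  ext i
  rw [coeff_apply hL (memLp_comp_wrap hL hG₀).1]
  have : comp L (fun x => G₀ (wrap L x)) i = fun t => (g i t : ℂ) := by
    funext t
    simp [comp, wrap_unwrap hL, G₀]
  rw [this, hgc]
  simp

theorem isWeakPartial_weakPartial {L : ℝ} (hL : 0 < L) {U : (Fin 2 → ℝ) → Vec}
    (hU : U ∈ spaceV L) (j : Fin 2) : IsWeakPartial L j U (weakPartial L j U) := by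
  have h := exists_isWeakPartial hL hU j
  rw [weakPartial, dif_pos h]
  exact h.choose_spec

theorem modCoeff_weakPartial_le {L : ℝ} (hL : 0 < L) {U : (Fin 2 → ℝ) → Vec}
    (hU : U ∈ spaceV L) (j : Fin 2) (n : Mode) :
    modCoeff L (weakPartial L j U) n ≤ waveMul L (modCoeff L U) n := by
  rw [modCoeff, (isWeakPartial_weakPartial hL hU j).2, enorm_smul, waveMul, modCoeff]
  gcongr
  rw [enorm_mul, ← ofReal_norm Complex.I, Complex.norm_I, ENNReal.ofReal_one, one_mul,
    ← ofReal_norm, Complex.norm_real, ofReal_norm]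
  exact enorm_apply_le _ _

/-! ### The coefficients of `B(U, U)`. -/

/-- The factor `4` counts two components of the field and two terms `u_j ∂_j`, each bounded by the
same convolution. -/
theorem coeff_advection_le {L : ℝ} (hL : 0 < L) {U : (Fin 2 → ℝ) → Vec} (hU : U ∈ spaceV L)
    (n : Mode) :
    ‖coeff L (advection L U U) n‖ₑ ≤
      4 * conv (modCoeff L U) (waveMul L (modCoeff L U)) n := by
  have hUm := hU.1.1
  have hG := fun j => (isWeakPartial_weakPartial hL hU j).1
  have hA : AEStronglyMeasurable (advection L U U) (cellMeasure L) := by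
    unfold advection
    exact Finset.aestronglyMeasurable_fun_sum _ fun j _ =>
      (memLp_apply hUm j).1.smul (hG j).1
  have hint : ∀ i j, Integrable (fun t => mFourier (-n) t •
      (comp L U j t * comp L (weakPartial L j U) i t)) volume := fun i j =>
    ((memLp_comp hL hUm j).integrable_mul (memLp_comp hL (hG j) i)).bdd_smul 1
      (mFourier (-n)).continuous.aestronglyMeasurable (ae_of_all _ fun t =>
        (ContinuousMap.norm_coe_le_norm _ t).trans_eq mFourier_norm)
  have hi : ∀ i, ‖coeff L (advection L U U) n i‖ₑ ≤
      2 * conv (modCoeff L U) (waveMul L (modCoeff L U)) n := fun i => by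
    have e : coeff L (advection L U U) n i =
        mFourierCoeff (fun t => comp L U 0 t * comp L (weakPartial L 0 U) i t) n +
        mFourierCoeff (fun t => comp L U 1 t * comp L (weakPartial L 1 U) i t) n := by
      rw [coeff_apply hL hA, mFourierCoeff, mFourierCoeff, mFourierCoeff,
        ← integral_add (hint i 0) (hint i 1)]
      congr 1
      funext t
      rw [← smul_add]
      congr 1
      simp [comp, advection, Fin.sum_univ_two]
    have hj : ∀ j, ‖mFourierCoeff (fun t => comp L U j t * comp L (weakPartial L j U) i t) n‖ₑ ≤
        conv (modCoeff L U) (waveMul L (modCoeff L U)) n := fun j =>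
      (absCoeff_mul_le (memLp_comp hL hUm j) (memLp_comp hL (hG j) i) n).trans
        (conv_mono (absCoeff_comp_le hL hUm.1 j)
          (fun k => (absCoeff_comp_le hL (hG j).1 i k).trans (modCoeff_weakPartial_le hL hU j k)) n)
    rw [e, two_mul]
    exact (enorm_add_le _ _).trans (add_le_add (hj 0) (hj 1))
  refine (enorm_le_add _).trans ((add_le_add (hi 0) (hi 1)).trans (le_of_eq ?_))
  ring

/-- By Cauchy–Schwarz the removed component along `k` is no longer than `c n`; the triangle
inequality then suffices, with `2` in place of the sharp `1`. -/
theorem enorm_leray_le (L : ℝ) (c : Mode → CVec) (n : Mode) : ‖leray L c n‖ₑ ≤ 2 * ‖c n‖ₑ := by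
  rw [leray]
  split_ifs with hn
  · simp
  set k : CVec := WithLp.toLp 2 fun i => ((wave L n i : ℝ) : ℂ) with hk
  have hkn : ‖k‖ = ‖wave L n‖ := by
    simp [EuclideanSpace.norm_eq, hk]
  have hin : ∑ i, ((wave L n i : ℝ) : ℂ) * c n i = inner ℂ k (c n) := by
    simp [PiLp.inner_apply, hk, mul_comm]
  have h2 : ‖((∑ i, ((wave L n i : ℝ) : ℂ) * c n i) / ((‖wave L n‖ ^ 2 : ℝ) : ℂ)) • k‖ ≤ ‖c n‖ := by
    rw [norm_smul, hin, norm_div, Complex.norm_real, Real.norm_of_nonneg (by positivity), ← hkn]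
    rcases eq_or_ne ‖k‖ 0 with h | h
    · simp [h]
    · have := norm_inner_le_norm (𝕜 := ℂ) k (c n)
      have hp : 0 < ‖k‖ := lt_of_le_of_ne (norm_nonneg _) h.symm
      rw [div_mul_eq_mul_div, div_le_iff₀ (by positivity)]
      nlinarith
  rw [two_mul]
  refine (enorm_sub_le).trans (add_le_add le_rfl ?_)
  rw [← ofReal_norm, ← ofReal_norm]
  exact ENNReal.ofReal_le_ofReal h2

theorem enorm_bilinB_le {L : ℝ} (hL : 0 < L) {U : (Fin 2 → ℝ) → Vec} (hU : U ∈ spaceV L)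
    (n : Mode) :
    ‖bilinB L U U n‖ₑ ≤ 8 * conv (modCoeff L U) (waveMul L (modCoeff L U)) n := by
  refine (enorm_leray_le L _ n).trans ((mul_le_mul_right (coeff_advection_le hL hU n) 2).trans ?_)
  refine le_of_eq ?_
  rw [← mul_assoc]
  norm_num

theorem bilinB_zero (L : ℝ) (U V : (Fin 2 → ℝ) → Vec) : bilinB L U V 0 = 0 := by
  simp [bilinB, leray]

/-! ### The three estimates. -/

/-- The weights `|k|` are subadditive under convolution. -/
theorem waveMul_conv_le (L : ℝ) (a b : Mode → ℝ≥0∞) (n : Mode) :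
    waveMul L (conv a b) n ≤ conv (waveMul L a) b n + conv a (waveMul L b) n := by
  rw [waveMul, conv, ← ENNReal.tsum_mul_left, conv, conv, ← ENNReal.tsum_add]
  refine ENNReal.tsum_le_tsum fun k => ?_
  have hw : wave L n = wave L k + wave L (n - k) := by
    ext i; simp [wave]; ring
  rw [hw, waveMul, waveMul]
  calc ‖wave L k + wave L (n - k)‖ₑ * (a k * b (n - k))
      ≤ (‖wave L k‖ₑ + ‖wave L (n - k)‖ₑ) * (a k * b (n - k)) := by
        gcongr; exact enorm_add_le _ _
    _ = _ := by ring

theorem sq_rpow_half (x : ℝ≥0∞) : (x ^ (1 / 2 : ℝ)) ^ 2 = x := by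
  rw [← ENNReal.rpow_two, ← ENNReal.rpow_mul]; norm_num

theorem rpow_half_mul_self (x : ℝ≥0∞) : x ^ (1 / 2 : ℝ) * x ^ (1 / 2 : ℝ) = x := by
  rw [← pow_two, sq_rpow_half]

theorem le_of_sq_le_sq' {x y : ℝ≥0∞} (h : x ^ 2 ≤ y ^ 2) : x ≤ y :=
  (ENNReal.pow_le_pow_left_iff two_ne_zero).1 h

/-- `ellTwo_conv_sq_le` without squares. -/
theorem ellTwo_conv_le {L : ℝ} (hL : 0 < L) {a b : Mode → ℝ≥0∞} (ha : a 0 = 0) (hb : b 0 = 0) :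
    ellTwo (conv a b) ≤ 4 * ENNReal.ofReal L *
      ((ellTwo a) ^ (1 / 2 : ℝ) * (ellTwo (waveMul L a)) ^ (1 / 2 : ℝ) *
        ((ellTwo b) ^ (1 / 2 : ℝ) * (ellTwo (waveMul L b)) ^ (1 / 2 : ℝ))) := by
  refine le_of_sq_le_sq' ((ellTwo_conv_sq_le hL ha hb).trans (le_of_eq ?_))
  simp only [mul_pow, sq_rpow_half]
  rw [ENNReal.ofReal_mul (by norm_num), ENNReal.ofReal_pow hL.le]
  norm_num

theorem ellTwo_conv_self_le {L : ℝ} (hL : 0 < L) {a : Mode → ℝ≥0∞} (ha : a 0 = 0) :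
    ellTwo (conv a a) ≤ 4 * ENNReal.ofReal L * (ellTwo a * ellTwo (waveMul L a)) := by
  refine (ellTwo_conv_le hL ha ha).trans (le_of_eq ?_)
  rw [mul_mul_mul_comm (ellTwo a ^ (1 / 2 : ℝ)), rpow_half_mul_self, rpow_half_mul_self]

/-- **Ladyzhenskaya's inequality**. -/
theorem eLpNorm_four_le {L : ℝ} (hL : 0 < L) {U : (Fin 2 → ℝ) → Vec} (hU : U ∈ spaceH L) :
    eLpNorm U 4 (cellMeasure L) ≤
      4 * sobolevNorm L 0 U ^ (1 / 2 : ℝ) * sobolevNorm L 1 U ^ (1 / 2 : ℝ) := by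
  have hUm := hU.1
  set l := ENNReal.ofReal L
  set x := ellTwo (modCoeff L U)
  set y := ellTwo (waveMul L (modCoeff L U))
  have hi : ∀ i, eLpNorm (comp L U i) 4 volume ≤
      2 * l ^ (1 / 2 : ℝ) * (x ^ (1 / 2 : ℝ) * y ^ (1 / 2 : ℝ)) := fun i => by
    refine le_of_sq_le_sq' ((eLpNorm_four_sq_le (memLp_comp hL hUm i)).trans ?_)
    refine (ellTwo_mono (conv_mono (absCoeff_comp_le hL hUm.1 i)
      (absCoeff_comp_le hL hUm.1 i))).trans ?_
    refine (ellTwo_conv_self_le hL (modCoeff_zero hU)).trans (le_of_eq ?_)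
    simp only [mul_pow, sq_rpow_half]
    norm_num [l, x, y]
  have hsum : eLpNorm (fun t => U (unwrap L t)) 4 volume ≤
      eLpNorm (comp L U 0) 4 volume + eLpNorm (comp L U 1) 4 volume := by
    have hm : ∀ i, AEStronglyMeasurable (fun t => ‖comp L U i t‖) volume := fun i =>
      (memLp_comp hL hUm i).1.norm
    have hpt : ∀ t, ‖U (unwrap L t)‖ ≤ ‖comp L U 0 t‖ + ‖comp L U 1 t‖ := fun t => by
      simpa only [comp, Complex.norm_real] using norm_le_add (U (unwrap L t))
    have h := eLpNorm_add_le (p := 4) (hm 0) (hm 1) (by norm_num)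
    rw [eLpNorm_norm, eLpNorm_norm] at h
    exact (eLpNorm_mono_real hpt).trans h
  rw [eLpNorm_cell hL (by norm_num) hUm.1, sobolevNorm_zero hL hU, sobolevNorm_one hL hU,
    ENNReal.mul_rpow_of_nonneg _ _ (by norm_num), ENNReal.mul_rpow_of_nonneg _ _ (by norm_num)]
  -- Rescaling `L⁴` gives `L^{1/2}`, and the convolution bound another `L^{1/2}`: exactly the powers
  -- in `|U|^{1/2} ‖U‖^{1/2}`.
  have hl : ENNReal.ofReal (L ^ 2) ^ (1 / 4 : ℝ≥0∞).toReal = l ^ (1 / 2 : ℝ) := by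
    rw [ENNReal.ofReal_pow hL.le, ← ENNReal.rpow_two, ← ENNReal.rpow_mul]
    norm_num
    rfl
  rw [hl]
  refine (mul_le_mul_right (hsum.trans (add_le_add (hi 0) (hi 1))) _).trans (le_of_eq ?_)
  ring

/-- The estimate of `B(U, U)` in `H`. -/
theorem coeffNorm_zero_bilinB_le {L : ℝ} (hL : 0 < L) {U : (Fin 2 → ℝ) → Vec}
    (hU : U ∈ spaceV L) :
    coeffNorm L 0 (bilinB L U U) ≤
      32 * sobolevNorm L 0 U ^ (1 / 2 : ℝ) * sobolevNorm L 1 U *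
        sobolevNorm L 2 U ^ (1 / 2 : ℝ) := by
  have h := coeffNorm_eq hL (bilinB_zero L U U) 0
  simp only [Nat.cast_zero, pow_zero, one_mul] at h
  have h0 := modCoeff_zero hU.1
  rw [h, sobolevNorm_zero hL hU.1, sobolevNorm_one hL hU.1, sobolevNorm_two hL hU.1,
    ENNReal.mul_rpow_of_nonneg _ _ (by norm_num), ENNReal.mul_rpow_of_nonneg _ _ (by norm_num)]
  have h1 := ellTwo_mono (enorm_bilinB_le hL hU)
  rw [ellTwo_const_mul] at h1
  refine (mul_le_mul_right (h1.trans (mul_le_mul_right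
    (ellTwo_conv_le hL h0 (waveMul_zero h0)) 8)) _).trans (le_of_eq ?_)
  set l := ENNReal.ofReal L
  set x := ellTwo (modCoeff L U)
  set y := ellTwo (waveMul L (modCoeff L U))
  set z := ellTwo (waveMul L (waveMul L (modCoeff L U)))
  calc l * (8 * (4 * l * (x ^ (1 / 2 : ℝ) * y ^ (1 / 2 : ℝ) *
        (y ^ (1 / 2 : ℝ) * z ^ (1 / 2 : ℝ)))))
      = 32 * l * l * x ^ (1 / 2 : ℝ) * (y ^ (1 / 2 : ℝ) * y ^ (1 / 2 : ℝ)) * z ^ (1 / 2 : ℝ) := by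
        ring
    _ = 32 * (l ^ (1 / 2 : ℝ) * l ^ (1 / 2 : ℝ)) * l * x ^ (1 / 2 : ℝ) * y *
          z ^ (1 / 2 : ℝ) := by rw [rpow_half_mul_self, rpow_half_mul_self]
    _ = _ := by ring

/-- The estimate of `B(U, U)` in `V`. -/
theorem coeffNorm_one_bilinB_le {L : ℝ} (hL : 0 < L) {U : (Fin 2 → ℝ) → Vec}
    (hU : U ∈ spaceV L) :
    coeffNorm L 1 (bilinB L U U) ≤
      64 * sobolevNorm L 1 U * sobolevNorm L 2 U +
        32 * sobolevNorm L 0 U ^ (1 / 2 : ℝ) * sobolevNorm L 2 U ^ (3 / 2 : ℝ) := by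
  have h := coeffNorm_eq hL (bilinB_zero L U U) 1
  simp only [Nat.cast_one, pow_one] at h
  have h0 := modCoeff_zero hU.1
  have h0' := waveMul_zero (L := L) h0
  rw [h, sobolevNorm_zero hL hU.1, sobolevNorm_one hL hU.1, sobolevNorm_two hL hU.1,
    ENNReal.mul_rpow_of_nonneg _ _ (by norm_num), ENNReal.mul_rpow_of_nonneg _ _ (by norm_num)]
  set l := ENNReal.ofReal L
  set c := modCoeff L U
  set d := waveMul L c with hd
  -- Subadditivity of `|k|` plays the part of the Leibniz rule.
  have hpt : ∀ n, ‖wave L n‖ₑ * ‖bilinB L U U n‖ₑ ≤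
      8 * (conv d d n + conv c (waveMul L d) n) := fun n => by
    calc ‖wave L n‖ₑ * ‖bilinB L U U n‖ₑ ≤ ‖wave L n‖ₑ * (8 * conv c d n) := by
          gcongr; exact enorm_bilinB_le hL hU n
      _ = 8 * waveMul L (conv c d) n := by rw [waveMul]; ring
      _ ≤ _ := by gcongr; exact waveMul_conv_le L c d n
  have h1 := ellTwo_mono hpt
  rw [ellTwo_const_mul] at h1
  have h2 : ellTwo (conv d d) ≤ 4 * l * (ellTwo d * ellTwo (waveMul L d)) :=
    ellTwo_conv_self_le hL h0'
  -- Young's inequality takes `c` in `ℓ¹` and `|k|d` in `ℓ²`; Agmon's inequality for `c` supplies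
  -- the additional half power of `|AU|`.
  have h3 : ellTwo (conv c (waveMul L d)) ≤
      2 * l * (ellTwo c ^ (1 / 2 : ℝ) * ellTwo (waveMul L d) ^ (3 / 2 : ℝ)) := by
    refine le_of_sq_le_sq' ?_
    rw [ellTwo_sq]
    refine (tsum_conv_sq_le_of_l1 c (waveMul L d)).trans ?_
    rw [← ellTwo_sq]
    refine (mul_le_mul_left (sq_tsum_le hL h0) _).trans (le_of_eq ?_)
    have e : ∀ z : ℝ≥0∞, (z ^ (3 / 2 : ℝ)) ^ 2 = z * z ^ 2 := fun z => by
      rw [← ENNReal.rpow_two, ← ENNReal.rpow_mul, ← pow_succ' z 2, ← ENNReal.rpow_natCast]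
      norm_num
    simp only [mul_pow, sq_rpow_half, e]
    rw [ENNReal.ofReal_mul (by norm_num), ENNReal.ofReal_pow hL.le, ENNReal.ofReal_ofNat]
    rw [← hd]
    ring
  have h4 : l ^ (1 / 2 : ℝ) * l ^ (3 / 2 : ℝ) = l * l := by
    rw [← ENNReal.rpow_add_of_nonneg _ _ (by norm_num) (by norm_num), ← pow_two,
      ← ENNReal.rpow_two]
    norm_num
  calc l * ellTwo (fun n => ‖wave L n‖ₑ * ‖bilinB L U U n‖ₑ)
      ≤ l * (8 * (2 * (4 * l * (ellTwo d * ellTwo (waveMul L d)) +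
          2 * l * (ellTwo c ^ (1 / 2 : ℝ) * ellTwo (waveMul L d) ^ (3 / 2 : ℝ))))) := by
        refine mul_le_mul_right (h1.trans (mul_le_mul_right ((ellTwo_add_le _ _).trans ?_) _)) _
        gcongr
    _ = 64 * (l * ellTwo d) * (l * ellTwo (waveMul L d)) + 32 * (l * l) *
          (ellTwo c ^ (1 / 2 : ℝ) * ellTwo (waveMul L d) ^ (3 / 2 : ℝ)) := by ring
    _ = 64 * (l * ellTwo d) * (l * ellTwo (waveMul L d)) +
          32 * (l ^ (1 / 2 : ℝ) * l ^ (3 / 2 : ℝ)) *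
          (ellTwo c ^ (1 / 2 : ℝ) * ellTwo (waveMul L d) ^ (3 / 2 : ℝ)) := by rw [h4]
    _ = _ := by ring

/-- Poincaré's inequality gives `D(A) ⊆ V`. -/
theorem domainA_subset_spaceV {L : ℝ} (hL : 0 < L) : domainA L ⊆ spaceV L := fun U hU => by
  refine ⟨hU.1, ?_⟩
  have h1 := hU.2
  rw [sobolevNorm_two hL hU.1] at h1
  rw [sobolevNorm_one hL hU.1]
  have hP := mul_ellTwo_le_ellTwo_waveMul hL (waveMul_zero (L := L) (modCoeff_zero hU.1))
  refine ENNReal.mul_lt_top ENNReal.ofReal_lt_top (lt_top_iff_ne_top.2 fun h => ?_)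
  have hκ : 0 < 2 * Real.pi / L := by positivity
  rw [h, ENNReal.mul_top (ENNReal.ofReal_pos.2 hκ).ne', top_le_iff] at hP
  rw [hP, ENNReal.mul_top (ENNReal.ofReal_pos.2 hL).ne'] at h1
  exact lt_irrefl _ h1

end Torus

end PeriodicNS

theorem mainTheorem9 :
    ∃ C₀ C₁ C₂ : ℝ≥0, ∀ L : ℝ, 0 < L →
      -- `C₀` is a constant of Ladyzhenskaya's inequality
      (∀ U ∈ PeriodicNS.spaceV L,
        eLpNorm U 4 (PeriodicNS.cellMeasure L) ≤
          C₀ * PeriodicNS.sobolevNorm L 0 U ^ (1 / 2 : ℝ) *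
            PeriodicNS.sobolevNorm L 1 U ^ (1 / 2 : ℝ)) ∧
      -- `|B(U,U)| ≤ C₀² |U|^{1/2} ‖U‖ |AU|^{1/2}`, where `|AU| = ∞` unless `U` is in `D(A)`
      (∀ U ∈ PeriodicNS.spaceV L,
        PeriodicNS.coeffNorm L 0 (PeriodicNS.bilinB L U U) ≤
          (C₀ : ℝ≥0∞) ^ 2 * PeriodicNS.sobolevNorm L 0 U ^ (1 / 2 : ℝ) *
            PeriodicNS.sobolevNorm L 1 U * PeriodicNS.sobolevNorm L 2 U ^ (1 / 2 : ℝ)) ∧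
      -- `‖B(U,U)‖ ≤ C₁ ‖U‖ |AU| + C₂ |U|^{1/2} |AU|^{3/2}`
      (∀ U ∈ PeriodicNS.domainA L,
        PeriodicNS.coeffNorm L 1 (PeriodicNS.bilinB L U U) ≤
          C₁ * PeriodicNS.sobolevNorm L 1 U * PeriodicNS.sobolevNorm L 2 U +
            C₂ * PeriodicNS.sobolevNorm L 0 U ^ (1 / 2 : ℝ) *
              PeriodicNS.sobolevNorm L 2 U ^ (3 / 2 : ℝ)) := by

  -- The same `C₀` serves twice: it has to satisfy `4 ≤ C₀` and `32 ≤ C₀²`.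
  refine ⟨6, 64, 32, fun L hL => ⟨fun U hU => ?_, fun U hU => ?_, fun U hU => ?_⟩⟩
  · refine (PeriodicNS.eLpNorm_four_le hL hU.1).trans ?_
    gcongr
    norm_num
  · refine (PeriodicNS.coeffNorm_zero_bilinB_le hL hU).trans ?_
    gcongr
    norm_num
  · exact_mod_cast
      PeriodicNS.coeffNorm_one_bilinB_le hL (PeriodicNS.domainA_subset_spaceV hL hU)
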